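/- Let $f:\mathbb{R}^d\to\mathbb{R}$ be differentiable. Metropolized Hamiltonian Monte Carlo (HMC) with target density proportional to $e^{-f}$, step size $\eta>0$ and step count $K\ge 1$ is the following Markov chain on $\mathbb{R}^d$. From the state $x$, draw $v_0\sim\mathcal{N}(0,\mathbf{I})$, put $x_0=x$, and perform for $0\le k<K$ the leapfrog steps $$v_{k+\frac12}=v_k-\tfrac{\eta}{2}\nabla f(x_k),\qquad x_{k+1}=x_k+\eta\, v_{k+\frac12},\qquad v_{k+1}=v_{k+\frac12}-\tfrac{\eta}{2}\nabla f(x_{k+1}).$$ Then move to $x_K$ with probability $\min\{1,\exp(\mathcal{H}(x_0,v_0)-\mathcal{H}(x_K,v_K))\}$, where $\mathcal{H}(x,v)=f(x)+\frac12\|v\|_2^2$, and otherwise stay at $x$. For a Markov chain with transition distributions $\mathcal{T}_x$ and stationary distribution $\pi^*$, the spectral gap is $$\lambda=\inf_g \frac{\mathcal{E}(g,g)}{\mathrm{Var}_{\pi^*}[g]},\qquad \mathcal{E}(g,g)=\int g(x)^2\,d\pi^*(x)-\iint g(y)g(x)\,\mathcal{T}_x(dy)\,d\pi^*(x),$$ where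 the infimum is over all $g\in L^2(\pi^*)$ with $\mathrm{Var}_{\pi^*}[g]>0$; the relaxation time is $1/\lambda\in(0,\infty]$. Theorem. For every $C>0$ there is a constant $c>0$, depending only on $C$, such that the following holds. Let $d\ge 2$ be an integer and let $10\le\kappa\le C d^4$. For every step size $\eta>0$ and every step count $K\ge 1$ there is a symmetric matrix $\mathbf{A}\in\mathbb{R}^{d\times d}$ with all eigenvalues in $[1,\kappa]$ such that, for the Gaussian target $\mathcal{N}(0,\mathbf{A}^{-1})$, whose negative log-density is $f(x)=\frac12 x^\top\mathbf{A}x$ up to an additive constant, the relaxation time of HMC with step size $\eta$ and step count $K$ is at least $$c\cdot\frac{\kappa\sqrt d}{K\sqrt{\log d}}.$$ -/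

import Mathlib

open MeasureTheory ProbabilityTheory
open scoped ENNReal

noncomputable section

namespace HMC

/-! ### Reversible chains: Dirichlet form, spectral gap, relaxation time -/

section Chain

variable {α : Type*} [MeasurableSpace α]

/-- The Dirichlet form
`𝓔(g, h) = ∫ g(x) h(x) dπ(x) - ∬ g(y) h(x) T_x(dy) dπ(x)`
of the Markov chain with transition distributions `T x` and stationary distribution `π`. -/
def dirichletForm (T : α → Measure α) (π : Measure α) (g h : α → ℝ) : ℝ :=
  (∫ x, g x * h x ∂π) - ∫ x, (∫ y, g y * h x ∂(T x)) ∂π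

/-- The spectral gap `inf_g 𝓔(g, g) / Var_π[g]`, over all `g ∈ L²(π)` that are not
almost surely constant.  The infimum is taken in `[0, ∞]`. -/
def spectralGap (T : α → Measure α) (π : Measure α) : ℝ≥0∞ :=
  ⨅ (g : α → ℝ) (_ : MemLp g 2 π) (_ : 0 < variance g π),
    ENNReal.ofReal (dirichletForm T π g g / variance g π)

/-- The relaxation time is the inverse spectral gap (`∞` if the gap is `0`). -/
def relaxationTime (T : α → Measure α) (π : Measure α) : ℝ≥0∞ :=
  (spectralGap T π)⁻¹

end Chain

/-! ### Metropolized Hamiltonian Monte Carlo with the leapfrog integrator -/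

section Leapfrog

variable {E : Type*} [NormedAddCommGroup E] [InnerProductSpace ℝ E] [FiniteDimensional ℝ E]

/-- The Hamiltonian `H(x, v) = f(x) + ‖v‖² / 2`. -/
def hamiltonian (f : E → ℝ) (p : E × E) : ℝ :=
  f p.1 + ‖p.2‖ ^ 2 / 2

/-- One leapfrog step `(x, v) ↦ (x', v')` with step size `η`:
`v_half = v - (η/2) ∇f(x)`, `x' = x + η v_half`, `v' = v_half - (η/2) ∇f(x')`. -/
def leapfrogStep (f : E → ℝ) (η : ℝ) (p : E × E) : E × E :=
  let vHalf : E := p.2 - (η / 2) • gradient f p.1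
  let x' : E := p.1 + η • vHalf
  (x', vHalf - (η / 2) • gradient f x')

/-- `K` leapfrog steps. -/
def leapfrog (f : E → ℝ) (η : ℝ) (K : ℕ) (p : E × E) : E × E :=
  (leapfrogStep f η)^[K] p

/-- The probability `min {1, exp(-H(x_K, v_K)) / exp(-H(x_0, v_0))}` of accepting the move
from `p = (x_0, v_0)`. -/
def acceptProb (f : E → ℝ) (η : ℝ) (K : ℕ) (p : E × E) : ℝ :=
  min 1 (Real.exp (-hamiltonian f (leapfrog f η K p)) / Real.exp (-hamiltonian f p))

variable [MeasurableSpace E] [BorelSpace E]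

/-- The transition distribution of Metropolized HMC from `x`: draw `v ∼ N(0, I)`, run `K`
leapfrog steps from `(x, v)`, move to the resulting position with probability `acceptProb`, and
otherwise stay at `x`. -/
def transition (f : E → ℝ) (η : ℝ) (K : ℕ) (x : E) : Measure E :=
  ((stdGaussian E).withDensity
      (fun v => ENNReal.ofReal (acceptProb f η K (x, v)))).map
    (fun v => (leapfrog f η K (x, v)).1)
  + (∫⁻ v, ENNReal.ofReal (1 - acceptProb f η K (x, v)) ∂(stdGaussian E)) • Measure.dirac x

/-- The probability measure with density proportional to `exp(-f)`. -/
def target (f : E → ℝ) : Measure E :=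
  (volume : Measure E).tilted (fun x => -f x)

end Leapfrog

/-- The quadratic `f(x) = (1/2) xᵀ A x` on `ℝᵈ`; for positive definite `A` it is, up to an
additive constant, the negative log-density of the Gaussian `N(0, A⁻¹)`, with Hessian `A`. -/
def quadratic {d : ℕ} (A : Matrix (Fin d) (Fin d) ℝ) (x : EuclideanSpace ℝ (Fin d)) : ℝ :=
  (1 / 2) * dotProduct x.ofLp (A.mulVec x.ofLp)

end HMC

end

open MeasureTheory ProbabilityTheory
open scoped ENNReal

noncomputable section

namespace HMC

/-! ### Chebyshev coefficients of the leapfrog integrator -/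

/-! Multiples `lam • 1` of the identity already suffice. For such a target the leapfrog map is
linear, and its coefficients after `K` steps are Chebyshev polynomials at `w = 1 - lam * η ^ 2 / 2`
(`leapfrog_isoQuad`). The gap is bounded above by three test functions.

For `lam = 1`, a linear functional gives gap at most `K² η²` (`spectralGap_isoQuad_one_le`): the
chain moves at most that far in mean square, by reversibility. With `q = κ η²` this proves the claim
when `K q √d` is of order at most `√(log d)`.

For larger `q`, the obstruction is rejection near the mode. Started at the mode, the trajectory has
energy error `a ‖v‖²` with `a = (lam η²)² U_{K-1}(w)² / 8`, so the mean acceptance is at most `(1 +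
2a)^(-d/2)`, and the indicator of a small ball carries this over to the gap
(`spectralGap_isoQuad_le_acceptProb_zero`). Once `a` is at least `10 log d / d` or `1/2`, this is
`O(d⁻⁵)`, enough because `κ √d ≤ C d⁵`.

It remains to make `a` large. If `q ≥ 4` the integrator is unstable at `lam = κ` and `|U_{K-1}| ≥
1`. If `q < 4`, write `w = cos φ`; the available curvatures contain `φ ∈ [θ/3, θ]`, where `cos θ = 1
- q/2`. Either some such `Kφ` is a multiple of `2π`, so the chain never moves, or `Kθ < 2π` and `φ =
θ/3` gives `a` of order `(Kq)²` (`exists_curvature`). -/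

/-- The coefficient `T_k(w)` of the initial position after `k` leapfrog steps. -/
def chebC (w : ℝ) (k : ℕ) : ℝ := (Polynomial.Chebyshev.T ℝ (k : ℤ)).eval w

/-- The coefficient `U_{k-1}(w)` of the initial velocity (in units of the step size) after `k`
leapfrog steps. -/
def chebS (w : ℝ) (k : ℕ) : ℝ := (Polynomial.Chebyshev.U ℝ ((k : ℤ) - 1)).eval w

@[simp] lemma chebC_zero (w : ℝ) : chebC w 0 = 1 := by simp [chebC]

@[simp] lemma chebS_zero (w : ℝ) : chebS w 0 = 0 := by
  simp [chebS, Polynomial.Chebyshev.U_neg_one]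

lemma chebC_succ (w : ℝ) (k : ℕ) :
    chebC w (k + 1) = w * chebC w k - (1 - w ^ 2) * chebS w k := by
  have h := congrArg (Polynomial.eval w)
    (Polynomial.Chebyshev.T_eq_X_mul_T_sub_pol_U ℝ ((k : ℤ) - 1))
  rw [show (k : ℤ) - 1 + 2 = ((k + 1 : ℕ) : ℤ) by push_cast; ring, sub_add_cancel] at h
  simpa [chebC, chebS] using h

lemma chebS_succ (w : ℝ) (k : ℕ) : chebS w (k + 1) = w * chebS w k + chebC w k := by
  have h := congrArg (Polynomial.eval w)
    (Polynomial.Chebyshev.U_eq_X_mul_U_add_T ℝ ((k : ℤ) - 1))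
  rw [sub_add_cancel] at h
  simpa [chebC, chebS] using h

/-- Pell's identity. It yields both the energy error from the mode and the involutivity of the
flipped leapfrog map. -/
lemma chebC_sq_add (w : ℝ) (k : ℕ) : chebC w k ^ 2 + (1 - w ^ 2) * chebS w k ^ 2 = 1 := by
  induction k with
  | zero => simp
  | succ k ih =>
    rw [chebC_succ, chebS_succ]
    linear_combination ih

lemma chebC_cos (θ : ℝ) (k : ℕ) : chebC (Real.cos θ) k = Real.cos (k * θ) := by
  simp [chebC, Polynomial.Chebyshev.T_real_cos]

lemma chebS_cos (θ : ℝ) (k : ℕ) :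
    chebS (Real.cos θ) k * Real.sin θ = Real.sin (k * θ) := by
  simp [chebS, Polynomial.Chebyshev.U_real_cos]

lemma abs_chebC_le {w : ℝ} (hw : |w| ≤ 1) (k : ℕ) : |chebC w k| ≤ 1 :=
  Polynomial.Chebyshev.abs_eval_T_real_le_one _ hw

lemma abs_chebS_le {w : ℝ} (hw : |w| ≤ 1) (k : ℕ) : |chebS w k| ≤ k := by
  induction k with
  | zero => simp
  | succ k ih =>
    rw [chebS_succ]
    have h1 : |w * chebS w k| ≤ k := by
      rw [abs_mul]
      calc |w| * |chebS w k| ≤ 1 * |chebS w k| := by gcongr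
        _ ≤ k := by simpa using ih
    push_cast
    exact (abs_add_le _ _).trans (add_le_add h1 (abs_chebC_le hw k))

/-- One step adds `(1 - w) (T_k + (1 + w) U_{k-1})`, at most `(1 - w) (1 + 2k)`, and these
increments sum to a square. -/
lemma one_sub_chebC_le {w : ℝ} (hw : |w| ≤ 1) (k : ℕ) :
    1 - chebC w k ≤ (k : ℝ) ^ 2 * (1 - w) := by
  induction k with
  | zero => simp
  | succ k ih =>
    obtain ⟨hw1, hw2⟩ := abs_le.1 hw
    have hc := (abs_le.1 (abs_chebC_le hw k)).2
    have hs := (abs_le.1 (abs_chebS_le hw k)).2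
    rw [chebC_succ]
    have h1 : (1 - w) * chebC w k ≤ (1 - w) * 1 := by gcongr
    have h2 : (1 - w) * ((1 + w) * chebS w k) ≤ (1 - w) * (2 * k) := by
      have hk : (0 : ℝ) ≤ k := k.cast_nonneg
      have : (1 + w) * chebS w k ≤ 2 * k := by nlinarith
      gcongr
    push_cast
    nlinarith

lemma one_sub_chebC_sq_le {w : ℝ} (hw : |w| ≤ 1) (k : ℕ) :
    (1 - chebC w k) ^ 2 ≤ 2 * ((k : ℝ) ^ 2 * (1 - w)) := by
  have h := one_sub_chebC_le hw k
  obtain ⟨h1, h2⟩ := abs_le.1 (abs_chebC_le hw k)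
  nlinarith

/-- Outside the stability region the velocity coefficient is bounded below. -/
lemma one_le_chebS_sq {w : ℝ} (hw : w ≤ -1) {k : ℕ} (hk : 1 ≤ k) : 1 ≤ chebS w k ^ 2 := by
  -- For `w ≤ -1` the coefficients alternate in sign. With the signs removed, the recursion has only
  -- nonnegative terms, so both bounds propagate together.
  have key : ∀ k : ℕ, 1 ≤ (-1) ^ k * chebC w k ∧ (k : ℝ) ≤ -((-1) ^ k * chebS w k) := by
    intro k
    induction k with
    | zero => simp
    | succ k ih =>
      obtain ⟨h1, h2⟩ := ih
      have hk : (0 : ℝ) ≤ k := k.cast_nonneg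
      rw [chebC_succ, chebS_succ, pow_succ]
      set c := (-1) ^ k * chebC w k
      set s := -((-1) ^ k * chebS w k)
      have e1 : (-1) ^ k * -1 * (w * chebC w k - (1 - w ^ 2) * chebS w k)
          = -w * c + (w ^ 2 - 1) * s := by simp only [c, s]; ring
      have e2 : -((-1) ^ k * -1 * (w * chebS w k + chebC w k)) = -w * s + c := by
        simp only [c, s]; ring
      rw [e1, e2]
      push_cast
      constructor
      · have : 0 ≤ (w ^ 2 - 1) * s := mul_nonneg (by nlinarith) (by linarith)
        nlinarith
      · nlinarith
  have h := (key k).2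
  have hk' : (1 : ℝ) ≤ k := by exact_mod_cast hk
  have hsq : chebS w k ^ 2 = (-((-1) ^ k * chebS w k)) ^ 2 := by
    rw [neg_sq, mul_pow, ← pow_mul, mul_comm k 2, pow_mul]; simp
  rw [hsq]
  nlinarith

/-! ### Leapfrog for an isotropic quadratic -/

section Isotropic

/-- The isotropic quadratic `(lam / 2) ‖x‖²`. -/
def isoQuad (E : Type*) [NormedAddCommGroup E] (lam : ℝ) (x : E) : ℝ := lam / 2 * ‖x‖ ^ 2

lemma continuous_hamiltonian_isoQuad {E : Type*} [NormedAddCommGroup E] (lam : ℝ) :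
    Continuous (hamiltonian (isoQuad E lam)) := by
  unfold hamiltonian isoQuad
  fun_prop

variable {E : Type*} [NormedAddCommGroup E] [InnerProductSpace ℝ E] [FiniteDimensional ℝ E]

lemma gradient_isoQuad (lam : ℝ) (x : E) : gradient (isoQuad E lam) x = lam • x := by
  apply HasGradientAt.gradient
  rw [hasGradientAt_iff_hasFDerivAt]
  have h := (hasStrictFDerivAt_norm_sq x).hasFDerivAt.const_mul (lam / 2)
  refine h.congr_fderiv ?_
  ext y
  simp
  ring

lemma leapfrogStep_isoQuad (lam η : ℝ) (p : E × E) :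
    leapfrogStep (isoQuad E lam) η p =
      ((1 - lam * η ^ 2 / 2) • p.1 + η • p.2,
        (1 - lam * η ^ 2 / 2) • p.2
          - (lam * η * (1 + (1 - lam * η ^ 2 / 2)) / 2) • p.1) := by
  simp only [leapfrogStep, gradient_isoQuad]
  ext1 <;> simp only <;> module

lemma leapfrog_isoQuad (lam η : ℝ) (K : ℕ) (p : E × E) :
    leapfrog (isoQuad E lam) η K p =
      (chebC (1 - lam * η ^ 2 / 2) K • p.1 + (η * chebS (1 - lam * η ^ 2 / 2) K) • p.2,
        chebC (1 - lam * η ^ 2 / 2) K • p.2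
          - (lam * η * (1 + (1 - lam * η ^ 2 / 2)) / 2 * chebS (1 - lam * η ^ 2 / 2) K) • p.1) := by
  induction K with
  | zero => simp [leapfrog]
  | succ K ih =>
    rw [leapfrog] at ih ⊢
    rw [Function.iterate_succ_apply', ih, leapfrogStep_isoQuad, chebC_succ, chebS_succ]
    ext1 <;> simp only <;> module

lemma continuous_leapfrog_isoQuad (lam η : ℝ) (K : ℕ) :
    Continuous (leapfrog (isoQuad E lam) η K) := by
  simp only [funext (leapfrog_isoQuad (E := E) lam η K)]
  fun_prop

lemma continuous_acceptProb_isoQuad (lam η : ℝ) (K : ℕ) :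
    Continuous (acceptProb (isoQuad E lam) η K) := by
  unfold acceptProb
  have h1 := continuous_hamiltonian_isoQuad (E := E) lam
  have h2 := h1.comp (continuous_leapfrog_isoQuad (E := E) lam η K)
  exact continuous_const.min ((Real.continuous_exp.comp h2.neg).div₀
    (Real.continuous_exp.comp h1.neg) fun _ => (Real.exp_pos _).ne')

lemma acceptProb_nonneg (f : E → ℝ) (η : ℝ) (K : ℕ) (p : E × E) : 0 ≤ acceptProb f η K p :=
  le_min zero_le_one (by positivity)

lemma acceptProb_le_one (f : E → ℝ) (η : ℝ) (K : ℕ) (p : E × E) : acceptProb f η K p ≤ 1 :=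
  min_le_left _ _

/-- Starting from the mode, the energy error is a multiple of the kinetic energy. -/
lemma acceptProb_isoQuad_zero_le (lam η : ℝ) (K : ℕ) (v : E) :
    acceptProb (isoQuad E lam) η K (0, v) ≤
      Real.exp (-((lam * η ^ 2) ^ 2 * chebS (1 - lam * η ^ 2 / 2) K ^ 2 / 8) * ‖v‖ ^ 2) := by
  refine (min_le_right _ _).trans_eq ?_
  rw [← Real.exp_sub, leapfrog_isoQuad]
  congr 1
  -- With `t = lam * η ^ 2`, the energy change is `‖v‖² / 2` times `(t - (1 - w²)) s²`, and `1 - w²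
  -- = t - t² / 4`.
  have h := chebC_sq_add (1 - lam * η ^ 2 / 2) K
  simp only [hamiltonian, isoQuad, smul_zero, zero_add, sub_zero, norm_smul, mul_pow,
    Real.norm_eq_abs, sq_abs, norm_zero]
  linear_combination (-‖v‖ ^ 2 / 2) * h

end Isotropic

/-! ### The Gaussian measures -/

section Gaussian

variable {E : Type*} [NormedAddCommGroup E] [InnerProductSpace ℝ E] [FiniteDimensional ℝ E]
  [MeasurableSpace E] [BorelSpace E]

lemma integrable_exp_neg_isoQuad {lam : ℝ} (hlam : 0 < lam) :
    Integrable (fun x : E => Real.exp (-isoQuad E lam x)) := by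
  apply Integrable.of_integral_ne_zero
  have h := GaussianFourier.integral_rexp_neg_mul_sq_norm (V := E) (half_pos hlam)
  simp only [isoQuad, ← neg_mul]
  rw [h]
  positivity

lemma isProbabilityMeasure_target_isoQuad {lam : ℝ} (hlam : 0 < lam) :
    IsProbabilityMeasure (target (isoQuad E lam)) :=
  isProbabilityMeasure_tilted (integrable_exp_neg_isoQuad hlam)

/-- Identifies the velocity law with a tilted Lebesgue measure, so that the joint law has density
proportional to `exp (-H)`; for `lam = 1` position and velocity have the same law. -/
lemma stdGaussian_eq_target : stdGaussian E = target (isoQuad E 1) := by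
  have := isProbabilityMeasure_target_isoQuad (E := E) one_pos
  apply Measure.ext_of_charFun
  ext t
  rw [charFun_stdGaussian, charFun_apply, target, integral_tilted]
  have hZ := GaussianFourier.integral_rexp_neg_mul_sq_norm (V := E) (b := 1 / 2) (by norm_num)
  have hI := GaussianFourier.integral_cexp_neg_mul_sq_norm_add (V := E) (b := 1 / 2)
    (by norm_num) Complex.I t
  simp only [isoQuad, ← neg_mul]
  rw [hZ]
  have e : ∀ x : E, (Real.exp (-(1 / 2) * ‖x‖ ^ 2)
        / (Real.pi / (1 / 2)) ^ ((Module.finrank ℝ E : ℝ) / 2)) •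
      Complex.exp ((inner ℝ x t : ℝ) * Complex.I)
      = (((Real.pi / (1 / 2)) ^ ((Module.finrank ℝ E : ℝ) / 2) : ℝ) : ℂ)⁻¹ *
        Complex.exp (-(1 / 2) * ‖x‖ ^ 2 + Complex.I * (inner ℝ t x : ℝ)) := by
    intro x
    rw [Complex.exp_add, real_inner_comm, Complex.real_smul]
    push_cast
    rw [mul_comm Complex.I]
    ring
  simp only [e]
  rw [integral_const_mul, hI, Complex.ofReal_cpow (by positivity)]
  have hne : ((Real.pi : ℂ) / (1 / 2)) ^ ((Module.finrank ℝ E : ℂ) / 2) ≠ 0 := by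
    rw [Ne, Complex.cpow_eq_zero_iff]
    simp [Real.pi_ne_zero]
  push_cast
  rw [inv_mul_cancel_left₀ hne]
  congr 1
  rw [Complex.I_sq]
  ring

lemma integral_exp_neg_mul_sq_norm_stdGaussian {a : ℝ} (ha : 0 ≤ a) :
    ∫ v, Real.exp (-a * ‖v‖ ^ 2) ∂(stdGaussian E)
      = (1 + 2 * a) ^ (-((Module.finrank ℝ E : ℝ) / 2)) := by
  rw [stdGaussian_eq_target, target, integral_tilted]
  have hZ := GaussianFourier.integral_rexp_neg_mul_sq_norm (V := E) (b := 1 / 2) (by norm_num)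
  have hI := GaussianFourier.integral_rexp_neg_mul_sq_norm (V := E) (b := a + 1 / 2)
    (by positivity)
  simp only [isoQuad, ← neg_mul]
  rw [hZ]
  simp only [smul_eq_mul, div_mul_eq_mul_div, ← Real.exp_add]
  rw [integral_div]
  have e : ∀ x : E, -(1 / 2) * ‖x‖ ^ 2 + -a * ‖x‖ ^ 2 = -(a + 1 / 2) * ‖x‖ ^ 2 := fun x => by ring
  simp only [e]
  rw [hI, ← Real.div_rpow (by positivity) (by positivity), Real.rpow_neg (by positivity),
    ← Real.inv_rpow (by positivity)]
  congr 1
  field_simp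
  ring

lemma variance_indicator_one {α : Type*} [MeasurableSpace α] (π : Measure α)
    [IsProbabilityMeasure π] {S : Set α} (hS : MeasurableSet S) :
    variance (S.indicator fun _ => (1 : ℝ)) π = π.real S * (1 - π.real S) := by
  rw [variance_eq_sub ((memLp_indicator_const 2 hS (1 : ℝ) (Or.inr (measure_ne_top _ _))))]
  have h2 : (S.indicator fun _ => (1 : ℝ)) ^ 2 = S.indicator fun _ => (1 : ℝ) := by
    ext x
    by_cases hx : x ∈ S <;> simp [hx]
  rw [h2, integral_indicator_const _ hS]
  simp
  ring

end Gaussian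

/-! ### The Dirichlet form of Metropolized HMC -/

section Dirichlet

variable {E : Type*} [NormedAddCommGroup E] [InnerProductSpace ℝ E] [FiniteDimensional ℝ E]
  [MeasurableSpace E] [BorelSpace E]

/-- The rejected mass contributes `g x * g x`, so only accepted moves change the value. -/
lemma integral_transition_isoQuad (lam η : ℝ) (K : ℕ) {g : E → ℝ} (hg : Measurable g) (x : E)
    (hX : Integrable (fun v => g (leapfrog (isoQuad E lam) η K (x, v)).1) (stdGaussian E)) :
    ∫ y, g y * g x ∂(transition (isoQuad E lam) η K x) =
      g x * g x - ∫ v, acceptProb (isoQuad E lam) η K (x, v) *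
        (g x * (g x - g (leapfrog (isoQuad E lam) η K (x, v)).1)) ∂(stdGaussian E) := by
  set α : E → ℝ := fun v => acceptProb (isoQuad E lam) η K (x, v)
  set X : E → E := fun v => (leapfrog (isoQuad E lam) η K (x, v)).1
  have hαc : Continuous α := (continuous_acceptProb_isoQuad lam η K).comp (by fun_prop)
  have hXc : Continuous X :=
    continuous_fst.comp ((continuous_leapfrog_isoQuad lam η K).comp (by fun_prop))
  have hα0 : ∀ v, 0 ≤ α v := fun v => acceptProb_nonneg _ _ _ _
  have hα1 : ∀ v, α v ≤ 1 := fun v => acceptProb_le_one _ _ _ _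
  have hαn : ∀ v, ‖α v‖ ≤ 1 := fun v => by
    rw [Real.norm_eq_abs, abs_of_nonneg (hα0 v)]; exact hα1 v
  have hαi : Integrable α (stdGaussian E) :=
    Integrable.of_bound hαc.aestronglyMeasurable 1 (ae_of_all _ hαn)
  have hαX : Integrable (fun v => α v * g (X v)) (stdGaussian E) :=
    hX.bdd_mul hαc.aestronglyMeasurable (ae_of_all _ hαn)
  have hd : ∫⁻ v, ENNReal.ofReal (1 - α v) ∂(stdGaussian E)
      = ENNReal.ofReal (1 - ∫ v, α v ∂(stdGaussian E)) := by
    have h := ofReal_integral_eq_lintegral_ofReal (f := fun v => 1 - α v)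
      ((integrable_const 1).sub hαi) (ae_of_all _ fun v => sub_nonneg.2 (hα1 v))
    rw [← h, integral_sub (integrable_const 1) hαi]
    simp
  have hle : 0 ≤ 1 - ∫ v, α v ∂(stdGaussian E) := by
    have := integral_mono hαi (integrable_const 1) hα1
    simpa using this
  have hgx : Measurable fun y => g y * g x := hg.mul_const _
  have hm : Measurable fun v => ENNReal.ofReal (α v) := hαc.measurable.ennreal_ofReal
  have hi1 : Integrable (fun y => g y * g x)
      (((stdGaussian E).withDensity fun v => ENNReal.ofReal (α v)).map X) := by
    rw [integrable_map_measure hgx.aestronglyMeasurable hXc.measurable.aemeasurable,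
      integrable_withDensity_iff_integrable_smul' hm (by simp)]
    refine (hαX.mul_const (g x)).congr (ae_of_all _ fun v => ?_)
    simp [ENNReal.toReal_ofReal (hα0 v), mul_assoc]
  have hi2 : Integrable (fun y => g y * g x)
      ((∫⁻ v, ENNReal.ofReal (1 - α v) ∂(stdGaussian E)) • Measure.dirac x) := by
    rw [hd]
    exact (integrable_dirac enorm_lt_top).smul_measure ENNReal.ofReal_ne_top
  rw [transition, integral_add_measure hi1 hi2, integral_smul_measure, integral_dirac, hd,
    integral_map hXc.measurable.aemeasurable hgx.aestronglyMeasurable,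
    integral_withDensity_eq_integral_toReal_smul hm (by simp), ENNReal.toReal_ofReal hle]
  have e1 : ∀ v, (ENNReal.ofReal (α v)).toReal • (g (X v) * g x) = α v * g (X v) * g x := fun v => by
    rw [ENNReal.toReal_ofReal (hα0 v), smul_eq_mul, mul_assoc]
  have e2 : ∀ v, α v * (g x * (g x - g (X v))) = α v * (g x * g x) - α v * g (X v) * g x :=
    fun v => by ring
  change _ = g x * g x - ∫ v, α v * (g x * (g x - g (X v))) ∂(stdGaussian E)
  simp only [e1, e2]
  rw [integral_sub (hαi.mul_const _) (hαX.mul_const _), integral_mul_const, smul_eq_mul]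
  simp only [integral_mul_const]
  ring

lemma dirichletForm_isoQuad {lam : ℝ} (hlam : 0 < lam) (η : ℝ) (K : ℕ) {g : E → ℝ}
    (hg : Measurable g) (hg2 : Integrable (fun x => g x * g x) (target (isoQuad E lam)))
    (hX : ∀ x, Integrable (fun v => g (leapfrog (isoQuad E lam) η K (x, v)).1) (stdGaussian E))
    (hJ : Integrable (fun p : E × E => acceptProb (isoQuad E lam) η K p *
      (g p.1 * (g p.1 - g (leapfrog (isoQuad E lam) η K p).1)))
      ((target (isoQuad E lam)).prod (stdGaussian E))) :
    dirichletForm (transition (isoQuad E lam) η K) (target (isoQuad E lam)) g g =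
      ∫ p, acceptProb (isoQuad E lam) η K p *
        (g p.1 * (g p.1 - g (leapfrog (isoQuad E lam) η K p).1))
        ∂((target (isoQuad E lam)).prod (stdGaussian E)) := by
  have := isProbabilityMeasure_target_isoQuad (E := E) hlam
  rw [dirichletForm, integral_prod _ hJ]
  simp only [integral_transition_isoQuad lam η K hg _ (hX _)]
  rw [integral_sub hg2 hJ.integral_prod_left]
  ring

lemma spectralGap_le {α : Type*} [MeasurableSpace α] {T : α → Measure α} {π : Measure α}
    {g : α → ℝ} {r : ℝ} (hg : MemLp g 2 π) (hv : 0 < variance g π)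
    (h : dirichletForm T π g g ≤ r * variance g π) :
    spectralGap T π ≤ ENNReal.ofReal r := by
  refine (iInf_le_of_le g (iInf_le_of_le hg (iInf_le_of_le hv ?_)))
  exact ENNReal.ofReal_le_ofReal ((div_le_iff₀ hv).2 h)

/-- Closed balls shrink to the null set `{0}`, while open balls have positive Lebesgue measure. The
bound `1 / 2` makes the variance of the indicator comparable to its mean. -/
lemma exists_ball_measure_le_half [Nontrivial E] {lam : ℝ} (hlam : 0 < lam) {U : Set E}
    (hU : U ∈ nhds (0 : E)) :
    ∃ r : ℝ, Metric.ball (0 : E) r ⊆ U ∧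
      0 < (target (isoQuad E lam)).real (Metric.ball 0 r) ∧
      (target (isoQuad E lam)).real (Metric.ball 0 r) ≤ 1 / 2 := by
  have := isProbabilityMeasure_target_isoQuad (E := E) hlam
  set π := target (isoQuad E lam) with hπ
  have h0 : π (Metric.closedBall (0 : E) 0) = 0 := by
    refine tilted_absolutelyContinuous volume _ ?_
    simp
  have ht := tendsto_measure_biInter_gt (μ := π) (s := fun r : ℝ => Metric.closedBall (0 : E) r)
    (a := 0) (fun r _ => Metric.isClosed_closedBall.measurableSet.nullMeasurableSet)
    (fun i j _ hij => Metric.closedBall_subset_closedBall hij) ⟨1, one_pos, measure_ne_top _ _⟩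
  have hinter : (⋂ r : ℝ, ⋂ (_ : r > 0), Metric.closedBall (0 : E) r) = Metric.closedBall 0 0 := by
    ext x
    simp only [Set.mem_iInter, Metric.mem_closedBall]
    exact ⟨fun h => le_of_forall_gt_imp_ge_of_dense fun r hr => h r hr,
      fun h r hr => h.trans (le_of_lt hr)⟩
  rw [hinter, h0] at ht
  have hev : ∀ᶠ r in nhdsWithin (0 : ℝ) (Set.Ioi 0), π (Metric.closedBall (0 : E) r) < 1 / 2 :=
    ht.eventually_lt_const (by simp)
  obtain ⟨ε, hε, hεU⟩ := Metric.mem_nhds_iff.1 hU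
  have hev2 : ∀ᶠ r in nhdsWithin (0 : ℝ) (Set.Ioi 0), r < ε :=
    nhdsWithin_le_nhds (Iio_mem_nhds hε)
  obtain ⟨r, ⟨hr1, hr2⟩, hr0⟩ := ((hev.and hev2).and self_mem_nhdsWithin).exists
  refine ⟨r, (Metric.ball_subset_ball hr2.le).trans hεU, ?_, ?_⟩
  · refine ENNReal.toReal_pos (fun h => ?_) (measure_ne_top _ _)
    have := absolutelyContinuous_tilted (integrable_exp_neg_isoQuad (E := E) hlam) h
    exact (Metric.measure_ball_pos volume (0 : E) hr0).ne' this
  · refine ENNReal.toReal_le_of_le_ofReal (by norm_num) ?_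
    refine (measure_mono Metric.ball_subset_closedBall).trans (hr1.le.trans ?_)
    rw [ENNReal.ofReal_div_of_pos two_pos]
    simp

/-- The indicator of a small ball at the mode bounds the spectral gap by the acceptance
probability at the mode. -/
lemma spectralGap_isoQuad_le_acceptProb_zero [Nontrivial E] {lam : ℝ} (hlam : 0 < lam) (η : ℝ)
    (K : ℕ) {r : ℝ}
    (hr : ∫ v, acceptProb (isoQuad E lam) η K (0, v) ∂(stdGaussian E) < r) :
    spectralGap (transition (isoQuad E lam) η K) (target (isoQuad E lam))
      ≤ ENNReal.ofReal (2 * r) := by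
  have := isProbabilityMeasure_target_isoQuad (E := E) hlam
  set α : E × E → ℝ := acceptProb (isoQuad E lam) η K with hα
  have hαc : Continuous α := continuous_acceptProb_isoQuad lam η K
  have hα0 : ∀ p, 0 ≤ α p := fun v => acceptProb_nonneg _ _ _ _
  have hα1 : ∀ p, α p ≤ 1 := fun v => acceptProb_le_one _ _ _ _
  have hαn : ∀ p, ‖α p‖ ≤ 1 := fun v => by
    rw [Real.norm_eq_abs, abs_of_nonneg (hα0 v)]; exact hα1 v
  -- By continuity, the strict acceptance bound at the mode persists on a small ball.
  have hcont : Continuous fun x : E => ∫ v, α (x, v) ∂(stdGaussian E) := by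
    refine continuous_of_dominated (bound := fun _ => 1)
      (fun x => (hαc.comp (by fun_prop)).aestronglyMeasurable)
      (fun x => ae_of_all _ fun v => hαn _) (integrable_const _)
      (ae_of_all _ fun v => hαc.comp (by fun_prop))
  obtain ⟨ρ, hρU, hpos, hhalf⟩ := exists_ball_measure_le_half (E := E) hlam
    (hcont.continuousAt.eventually_lt_const hr)
  set S := Metric.ball (0 : E) ρ with hSdef
  have hS : MeasurableSet S := Metric.isOpen_ball.measurableSet
  set π := target (isoQuad E lam) with hπ
  set g : E → ℝ := S.indicator fun _ => 1 with hgdef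
  have hg : Measurable g := measurable_const.indicator hS
  have hg0 : ∀ x, 0 ≤ g x := fun x => Set.indicator_nonneg (fun _ _ => zero_le_one) x
  have hg1 : ∀ x, g x ≤ 1 := fun x => Set.indicator_le_self' (fun _ _ => zero_le_one) x
  have hgmem : MemLp g 2 π := memLp_indicator_const 2 hS (1 : ℝ) (Or.inr (measure_ne_top _ _))
  have hXm : Measurable fun p : E × E => (leapfrog (isoQuad E lam) η K p).1 :=
    (continuous_fst.comp (continuous_leapfrog_isoQuad lam η K)).measurable
  have hgX : Measurable fun p : E × E => g (leapfrog (isoQuad E lam) η K p).1 := hg.comp hXm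
  have hJm : Measurable fun p : E × E =>
      α p * (g p.1 * (g p.1 - g (leapfrog (isoQuad E lam) η K p).1)) :=
    hαc.measurable.mul ((hg.comp measurable_fst).mul ((hg.comp measurable_fst).sub hgX))
  have hJle : ∀ p : E × E,
      α p * (g p.1 * (g p.1 - g (leapfrog (isoQuad E lam) η K p).1)) ≤ g p.1 * α p := fun p => by
    have h1 := hg0 p.1
    have h2 := hg1 p.1
    have h3 := hg0 (leapfrog (isoQuad E lam) η K p).1
    rw [mul_comm (g p.1) (α p)]
    refine mul_le_mul_of_nonneg_left ?_ (hα0 p)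
    nlinarith
  have hJ : Integrable (fun p : E × E =>
      α p * (g p.1 * (g p.1 - g (leapfrog (isoQuad E lam) η K p).1)))
      (π.prod (stdGaussian E)) := by
    refine Integrable.of_bound hJm.aestronglyMeasurable 1 (ae_of_all _ fun p => ?_)
    rw [norm_mul, norm_mul]
    have h1 : ‖g p.1‖ ≤ 1 := by
      rw [Real.norm_eq_abs, abs_of_nonneg (hg0 _)]; exact hg1 _
    have h2 : ‖g p.1 - g (leapfrog (isoQuad E lam) η K p).1‖ ≤ 1 := by
      rw [Real.norm_eq_abs, abs_le]
      constructor <;> linarith [hg0 p.1, hg1 p.1, hg0 (leapfrog (isoQuad E lam) η K p).1,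
        hg1 (leapfrog (isoQuad E lam) η K p).1]
    exact mul_le_one₀ (hαn p) (by positivity) (mul_le_one₀ h1 (norm_nonneg _) h2)
  have hgα : Integrable (fun p : E × E => g p.1 * α p) (π.prod (stdGaussian E)) := by
    refine Integrable.of_bound
      ((hg.comp measurable_fst).mul hαc.measurable).aestronglyMeasurable 1 (ae_of_all _ fun p => ?_)
    rw [norm_mul]
    have h1 : ‖g p.1‖ ≤ 1 := by
      rw [Real.norm_eq_abs, abs_of_nonneg (hg0 _)]; exact hg1 _
    exact mul_le_one₀ h1 (norm_nonneg _) (hαn p)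
  have hr0 : 0 < r := (integral_nonneg fun v => hα0 _).trans_lt hr
  have hvar : variance g π = π.real S * (1 - π.real S) := variance_indicator_one π hS
  refine spectralGap_le hgmem (by rw [hvar]; nlinarith) ?_
  rw [dirichletForm_isoQuad hlam η K hg (by simpa [sq] using hgmem.integrable_sq) (fun x => by
    refine Integrable.of_bound (hgX.comp measurable_prodMk_left).aestronglyMeasurable 1
      (ae_of_all _ fun v => ?_)
    rw [Real.norm_eq_abs, abs_of_nonneg (hg0 _)]
    exact hg1 _) hJ]
  calc _ ≤ ∫ p, g p.1 * α p ∂(π.prod (stdGaussian E)) := integral_mono hJ hgα hJle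
    _ = ∫ x, g x * ∫ v, α (x, v) ∂(stdGaussian E) ∂π := by
        rw [integral_prod _ hgα]
        simp only [integral_const_mul]
    _ ≤ ∫ x, g x * r ∂π := by
        refine integral_mono ?_ ((hgmem.integrable one_le_two).mul_const r) fun x => ?_
        · simpa only [integral_const_mul] using hgα.integral_prod_left
        · by_cases hx : x ∈ S
          · exact mul_le_mul_of_nonneg_left (le_of_lt (hρU hx)) (hg0 x)
          · simp [hgdef, hx]
    _ = π.real S * r := by
        rw [integral_mul_const, integral_indicator_const _ hS]
        simp
    -- The factor `2` pays for `1 - π.real S ≥ 1 / 2`.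
    _ ≤ 2 * r * variance g π := by
        rw [hvar]
        nlinarith [mul_pos hpos hr0]

/-- If the leapfrog trajectory is periodic, the chain never moves. -/
lemma spectralGap_isoQuad_eq_zero [Nontrivial E] {lam : ℝ} (hlam : 0 < lam) (η : ℝ) (K : ℕ)
    (hc : chebC (1 - lam * η ^ 2 / 2) K = 1) (hs : chebS (1 - lam * η ^ 2 / 2) K = 0) :
    spectralGap (transition (isoQuad E lam) η K) (target (isoQuad E lam)) = 0 := by
  have := isProbabilityMeasure_target_isoQuad (E := E) hlam
  obtain ⟨ρ, -, hpos, hhalf⟩ := exists_ball_measure_le_half (E := E) hlam Filter.univ_mem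
  have hS : MeasurableSet (Metric.ball (0 : E) ρ) := Metric.isOpen_ball.measurableSet
  set π := target (isoQuad E lam) with hπ
  set g : E → ℝ := (Metric.ball (0 : E) ρ).indicator fun _ => 1 with hgdef
  have hg : Measurable g := measurable_const.indicator hS
  have hgmem : MemLp g 2 π := memLp_indicator_const 2 hS (1 : ℝ) (Or.inr (measure_ne_top _ _))
  have hX : ∀ p : E × E, (leapfrog (isoQuad E lam) η K p).1 = p.1 := fun p => by
    simp [leapfrog_isoQuad, hc, hs]
  have h := spectralGap_le (T := transition (isoQuad E lam) η K) (r := 0) hgmem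
    (by rw [variance_indicator_one π hS]; nlinarith) (by
      rw [dirichletForm_isoQuad hlam η K hg (by simpa [sq] using hgmem.integrable_sq)
        (by simp [hX]) (by simp [hX])]
      simp [hX])
  simpa using h

end Dirichlet

/-! ### Reversibility and the linear test function -/

section Reversible

variable {E : Type*} [NormedAddCommGroup E] [InnerProductSpace ℝ E]

/-- The leapfrog map followed by a flip of the velocity. -/
def flipLeapfrog (E : Type*) [NormedAddCommGroup E] [InnerProductSpace ℝ E]
    (lam η : ℝ) (K : ℕ) : E × E →ₗ[ℝ] E × E :=
  LinearMap.prod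
    (chebC (1 - lam * η ^ 2 / 2) K • LinearMap.fst ℝ E E
      + (η * chebS (1 - lam * η ^ 2 / 2) K) • LinearMap.snd ℝ E E)
    ((lam * η * (1 + (1 - lam * η ^ 2 / 2)) / 2 * chebS (1 - lam * η ^ 2 / 2) K) •
        LinearMap.fst ℝ E E
      - chebC (1 - lam * η ^ 2 / 2) K • LinearMap.snd ℝ E E)

lemma flipLeapfrog_involutive (lam η : ℝ) (K : ℕ) :
    Function.Involutive (flipLeapfrog E lam η K) := by
  intro p
  have h := chebC_sq_add (1 - lam * η ^ 2 / 2) K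
  set c := chebC (1 - lam * η ^ 2 / 2) K with hc
  set s := chebS (1 - lam * η ^ 2 / 2) K with hs
  set b := lam * η * (1 + (1 - lam * η ^ 2 / 2)) / 2 * s with hb
  have h' : c * c + η * s * b = 1 := by rw [hb]; linear_combination h
  have e : ∀ q : E × E, flipLeapfrog E lam η K q = (c • q.1 + (η * s) • q.2, b • q.1 - c • q.2) :=
    fun q => by ext1 <;> simp [flipLeapfrog, ← hc, ← hs, ← hb]
  rw [e, e]
  ext1
  · simp only
    calc _ = (c * c + η * s * b) • p.1 := by module
      _ = p.1 := by rw [h', one_smul]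
  · simp only
    calc _ = (c * c + η * s * b) • p.2 := by module
      _ = p.2 := by rw [h', one_smul]

variable [FiniteDimensional ℝ E]

lemma flipLeapfrog_apply (lam η : ℝ) (K : ℕ) (p : E × E) :
    flipLeapfrog E lam η K p = ((leapfrog (isoQuad E lam) η K p).1,
      -(leapfrog (isoQuad E lam) η K p).2) := by
  rw [leapfrog_isoQuad]
  ext1
  · simp [flipLeapfrog]
  · simp [flipLeapfrog]

variable [MeasurableSpace E] [BorelSpace E]

/-- A linear involution has determinant `±1`. -/
lemma measurePreserving_flipLeapfrog (lam η : ℝ) (K : ℕ) :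
    MeasurePreserving (flipLeapfrog E lam η K)
      ((volume : Measure E).prod volume) ((volume : Measure E).prod volume) := by
  have hinv : flipLeapfrog E lam η K ∘ₗ flipLeapfrog E lam η K = LinearMap.id :=
    LinearMap.ext (flipLeapfrog_involutive lam η K)
  have hdet : LinearMap.det (flipLeapfrog E lam η K) * LinearMap.det (flipLeapfrog E lam η K)
      = 1 := by
    rw [← LinearMap.det_comp, hinv, LinearMap.det_id]
  have hne : LinearMap.det (flipLeapfrog E lam η K) ≠ 0 := by
    intro h0
    simp [h0] at hdet
  have habs : |(LinearMap.det (flipLeapfrog E lam η K))⁻¹| = 1 := by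
    rcases mul_self_eq_one_iff.1 hdet with h | h <;> simp [h]
  refine ⟨(LinearMap.continuous_of_finiteDimensional _).measurable, ?_⟩
  rw [Measure.map_linearMap_addHaar_eq_smul_addHaar _ hne, habs]
  simp

/-- The constant `Z` is the same for every `F`, with no integrability assumed, so detailed balance
reduces to an identity of Lebesgue integrals. -/
lemma exists_integral_target_prod_stdGaussian (lam : ℝ) :
    ∃ Z : ℝ, ∀ F : E × E → ℝ, ∫ p, F p ∂((target (isoQuad E lam)).prod (stdGaussian E)) =
      Z * ∫ p, Real.exp (-hamiltonian (isoQuad E lam) p) * F p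
        ∂((volume : Measure E).prod volume) := by
  have hm : ∀ l : ℝ, Measurable fun x : E => ENNReal.ofReal (Real.exp (-isoQuad E l x) /
      ∫ x : E, Real.exp (-isoQuad E l x)) := fun l => by
    unfold isoQuad
    fun_prop
  refine ⟨((∫ x : E, Real.exp (-isoQuad E lam x)) * ∫ x : E, Real.exp (-isoQuad E 1 x))⁻¹,
    fun F => ?_⟩
  have hm2 := fun l => ((hm l).comp (measurable_fst (β := E))).mul ((hm 1).comp measurable_snd)
  rw [stdGaussian_eq_target, target, target, Measure.tilted, Measure.tilted,
    prod_withDensity (hm _) (hm _)]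
  refine (integral_withDensity_eq_integral_toReal_smul (hm2 lam) (ae_of_all _ fun p =>
    ENNReal.mul_lt_top ENNReal.ofReal_lt_top ENNReal.ofReal_lt_top) F).trans ?_
  rw [← integral_const_mul]
  congr 1
  ext p
  simp only [Pi.mul_apply, Function.comp_apply]
  have hZ : ∀ l : ℝ, 0 ≤ ∫ x : E, Real.exp (-isoQuad E l x) := fun l =>
    integral_nonneg fun x => (Real.exp_pos _).le
  have he : -hamiltonian (isoQuad E lam) p = -isoQuad E lam p.1 + -isoQuad E 1 p.2 := by
    simp only [hamiltonian, isoQuad]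
    ring
  rw [ENNReal.toReal_mul, ENNReal.toReal_ofReal (div_nonneg (Real.exp_pos _).le (hZ _)),
    ENNReal.toReal_ofReal (div_nonneg (Real.exp_pos _).le (hZ _)), he, Real.exp_add, smul_eq_mul,
    mul_inv]
  ring

/-- Detailed balance: the accepted part of the HMC move is symmetric in its endpoints. -/
lemma integral_acceptProb_mul_comp_leapfrog (lam η : ℝ) (K : ℕ) (F : E → ℝ) :
    ∫ p, acceptProb (isoQuad E lam) η K p * F (leapfrog (isoQuad E lam) η K p).1
        ∂((target (isoQuad E lam)).prod (stdGaussian E)) =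
      ∫ p, acceptProb (isoQuad E lam) η K p * F p.1
        ∂((target (isoQuad E lam)).prod (stdGaussian E)) := by
  obtain ⟨Z, hZ⟩ := exists_integral_target_prod_stdGaussian (E := E) lam
  rw [hZ, hZ]
  congr 1
  set Φ := flipLeapfrog E lam η K with hΦ
  have hΦ2 : ∀ p, Φ (Φ p) = p := flipLeapfrog_involutive lam η K
  set ρ : E × E → ℝ := fun p => Real.exp (-hamiltonian (isoQuad E lam) p) with hρ
  have hfst : ∀ p, (leapfrog (isoQuad E lam) η K p).1 = (Φ p).1 := fun p => by
    rw [hΦ, flipLeapfrog_apply]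
  -- The Metropolis weight becomes `min (ρ p) (ρ (Φ p))`, symmetric under the involution `Φ`.
  have hacc : ∀ p, ρ p * acceptProb (isoQuad E lam) η K p = min (ρ p) (ρ (Φ p)) := fun p => by
    have h : ρ (Φ p)
        = Real.exp (-hamiltonian (isoQuad E lam) (leapfrog (isoQuad E lam) η K p)) := by
      rw [hΦ, flipLeapfrog_apply]
      simp [hρ, hamiltonian]
    have hpos : 0 < ρ p := Real.exp_pos _
    rw [acceptProb, ← h, mul_min_of_nonneg _ _ hpos.le, mul_one]
    congr 1
    exact mul_div_cancel₀ _ hpos.ne'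
  have hemb : MeasurableEmbedding Φ :=
    (LinearEquiv.ofInvolutive Φ hΦ2).toContinuousLinearEquiv.toHomeomorph.measurableEmbedding
  rw [← (measurePreserving_flipLeapfrog (E := E) lam η K).integral_comp hemb]
  congr 1
  ext p
  rw [← mul_assoc, ← mul_assoc]
  change ρ (Φ p) * acceptProb (isoQuad E lam) η K (Φ p) * _
    = ρ p * acceptProb (isoQuad E lam) η K p * _
  rw [hacc, hacc, hfst, hΦ2, min_comm]

/-- The linear test function bounds the spectral gap for the standard Gaussian by the square of
the integration time. -/
lemma spectralGap_isoQuad_one_le [Nontrivial E] (η : ℝ) (K : ℕ) (hη : η ^ 2 ≤ 4) :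
    spectralGap (transition (isoQuad E 1) η K) (target (isoQuad E 1))
      ≤ ENNReal.ofReal ((K : ℝ) ^ 2 * η ^ 2) := by
  obtain ⟨e, he⟩ := exists_norm_eq E zero_le_one
  set g : StrongDual ℝ E := innerSL ℝ e with hgdef
  have hgn : ‖g‖ = 1 := by rw [hgdef, innerSL_apply_norm, he]
  set γ := stdGaussian E with hγ
  set c := chebC (1 - 1 * η ^ 2 / 2) K with hc
  set s := chebS (1 - 1 * η ^ 2 / 2) K with hs
  set α : E × E → ℝ := acceptProb (isoQuad E 1) η K with hα
  have hαc : Continuous α := continuous_acceptProb_isoQuad 1 η K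
  have hα0 : ∀ p, 0 ≤ α p := fun v => acceptProb_nonneg _ _ _ _
  have hα1 : ∀ p, α p ≤ 1 := fun v => acceptProb_le_one _ _ _ _
  have hαn : ∀ p, ‖α p‖ ≤ 1 := fun v => by
    rw [Real.norm_eq_abs, abs_of_nonneg (hα0 v)]; exact hα1 v
  have hgm : MemLp g 2 γ := IsGaussian.memLp_dual γ g 2 (by simp)
  have hgi : Integrable g γ := hgm.integrable one_le_two
  have hg2 : Integrable (fun x => g x * g x) γ := by simpa [sq] using hgm.integrable_sq
  have hmean : ∫ x, g x ∂γ = 0 := integral_strongDual_stdGaussian g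
  have hvar : variance g γ = 1 := by rw [variance_dual_stdGaussian, hgn, one_pow]
  have hmom : ∫ x, g x * g x ∂γ = 1 := by
    have h := variance_eq_sub hgm
    rw [hvar, hmean] at h
    simpa [sq] using h.symm
  have hX : ∀ p : E × E, g (leapfrog (isoQuad E 1) η K p).1 = c * g p.1 + η * s * g p.2 :=
    fun p => by rw [leapfrog_isoQuad]; simp [hc, hs]
  have i11 : Integrable (fun p : E × E => g p.1 * g p.1) (γ.prod γ) := hg2.comp_fst γ
  have i22 : Integrable (fun p : E × E => g p.2 * g p.2) (γ.prod γ) := hg2.comp_snd γ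
  have i12 : Integrable (fun p : E × E => g p.1 * g p.2) (γ.prod γ) := hgi.mul_prod hgi
  have m11 : ∫ p : E × E, g p.1 * g p.1 ∂(γ.prod γ) = 1 := by
    rw [integral_fun_fst (fun x => g x * g x)]; simp [hmom]
  have m22 : ∫ p : E × E, g p.2 * g p.2 ∂(γ.prod γ) = 1 := by
    rw [integral_fun_snd (fun x => g x * g x)]; simp [hmom]
  have m12 : ∫ p : E × E, g p.1 * g p.2 ∂(γ.prod γ) = 0 := by
    rw [integral_prod_mul, hmean, zero_mul]
  have bdd : ∀ {F : E × E → ℝ}, Integrable F (γ.prod γ) →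
      Integrable (fun p => α p * F p) (γ.prod γ) := fun hF =>
    hF.bdd_mul hαc.aestronglyMeasurable (ae_of_all _ hαn)
  have iXX : Integrable (fun p : E × E => g (leapfrog (isoQuad E 1) η K p).1 *
      g (leapfrog (isoQuad E 1) η K p).1) (γ.prod γ) := by
    refine (((i11.const_mul (c ^ 2)).add (i12.const_mul (2 * c * (η * s)))).add
      (i22.const_mul ((η * s) ^ 2))).congr (ae_of_all _ fun p => ?_)
    simp only [hX, Pi.add_apply]
    ring
  have iJ : Integrable (fun p : E × E => g p.1 * (g p.1 - g (leapfrog (isoQuad E 1) η K p).1))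
      (γ.prod γ) := by
    refine ((i11.const_mul (1 - c)).sub (i12.const_mul (η * s))).congr (ae_of_all _ fun p => ?_)
    simp only [hX, Pi.sub_apply]
    ring
  have iD : Integrable (fun p : E × E => (1 - c) ^ 2 * (g p.1 * g p.1)
      - 2 * (1 - c) * (η * s) * (g p.1 * g p.2) + (η * s) ^ 2 * (g p.2 * g p.2)) (γ.prod γ) :=
    ((i11.const_mul _).sub (i12.const_mul _)).add (i22.const_mul _)
  have hrev := integral_acceptProb_mul_comp_leapfrog (E := E) 1 η K (fun x => g x * g x)
  have hJ := dirichletForm_isoQuad (E := E) one_pos η K (g := g) g.continuous.measurable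
  rw [← stdGaussian_eq_target] at hrev hJ ⊢
  refine spectralGap_le hgm (by rw [hvar]; exact one_pos) ?_
  rw [hJ hg2 (fun x => by
    simp only [hX]
    exact (integrable_const _).add (hgi.const_mul _)) (bdd iJ), hvar, mul_one]
  have hw : |1 - 1 * η ^ 2 / 2| ≤ 1 := by
    rw [abs_le]
    constructor <;> nlinarith [sq_nonneg η]
  have hcK : (1 - c) ^ 2 ≤ (K : ℝ) ^ 2 * η ^ 2 := by
    have := one_sub_chebC_sq_le hw K
    rw [← hc] at this
    linarith
  have hsK : (η * s) ^ 2 ≤ (K : ℝ) ^ 2 * η ^ 2 := by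
    have := sq_le_sq' (neg_le_of_abs_le (abs_chebS_le hw K)) (le_of_abs_le (abs_chebS_le hw K))
    rw [← hs] at this
    nlinarith [sq_nonneg η]
  have hD : ∀ p : E × E, (1 - c) ^ 2 * (g p.1 * g p.1)
      - 2 * (1 - c) * (η * s) * (g p.1 * g p.2) + (η * s) ^ 2 * (g p.2 * g p.2)
      = (g p.1 - g (leapfrog (isoQuad E 1) η K p).1) ^ 2 := fun p => by
    rw [hX]; ring
  -- Detailed balance for `g²` equates the two square terms, turning the form into half the mean
  -- accepted squared displacement.
  have hsplit : ∫ p, α p * (g p.1 * (g p.1 - g (leapfrog (isoQuad E 1) η K p).1)) ∂(γ.prod γ)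
      = 1 / 2 * ∫ p, α p * (g p.1 - g (leapfrog (isoQuad E 1) η K p).1) ^ 2 ∂(γ.prod γ) := by
    have h1 : ∀ p : E × E, α p * (g p.1 * (g p.1 - g (leapfrog (isoQuad E 1) η K p).1))
        = 1 / 2 * (α p * (g p.1 - g (leapfrog (isoQuad E 1) η K p).1) ^ 2)
          + 1 / 2 * (α p * (g p.1 * g p.1) - α p * (g (leapfrog (isoQuad E 1) η K p).1 *
            g (leapfrog (isoQuad E 1) η K p).1)) := fun p => by ring
    have h2 : Integrable (fun p => α p * (g p.1 - g (leapfrog (isoQuad E 1) η K p).1) ^ 2)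
        (γ.prod γ) := by
      simpa only [hD] using bdd iD
    have h3 : Integrable (fun p : E × E => 1 / 2 * (α p * (g p.1 * g p.1) -
        α p * (g (leapfrog (isoQuad E 1) η K p).1 * g (leapfrog (isoQuad E 1) η K p).1)))
        (γ.prod γ) := ((bdd i11).sub (bdd iXX)).const_mul _
    simp only [h1]
    rw [integral_add (h2.const_mul _) h3, integral_const_mul, integral_const_mul,
      integral_sub (bdd i11) (bdd iXX), hrev]
    ring
  rw [hsplit]
  have hle : ∫ p, α p * (g p.1 - g (leapfrog (isoQuad E 1) η K p).1) ^ 2 ∂(γ.prod γ)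
      ≤ (1 - c) ^ 2 + (η * s) ^ 2 := by
    calc _ ≤ ∫ p : E × E, ((1 - c) ^ 2 * (g p.1 * g p.1)
          - 2 * (1 - c) * (η * s) * (g p.1 * g p.2) + (η * s) ^ 2 * (g p.2 * g p.2))
          ∂(γ.prod γ) := by
          refine integral_mono (by simpa only [hD] using bdd iD) iD fun p => ?_
          simp only [hD]
          exact mul_le_of_le_one_left (sq_nonneg _) (hα1 p)
      _ = (1 - c) ^ 2 + (η * s) ^ 2 := by
          have h12 : Integrable (fun p : E × E => (1 - c) ^ 2 * (g p.1 * g p.1)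
              - 2 * (1 - c) * (η * s) * (g p.1 * g p.2)) (γ.prod γ) :=
            (i11.const_mul _).sub (i12.const_mul _)
          rw [integral_add h12 (i22.const_mul _), integral_sub (i11.const_mul _) (i12.const_mul _),
            integral_const_mul,
            integral_const_mul, integral_const_mul, m11, m12, m22]
          ring
  linarith

end Reversible

/-! ### Choice of the curvature -/

/-- Halve the angle: Jordan's inequality bounds `sin (y / 2)`, and `cos (y / 2) ≥ 1 / 2` on this
range. -/
lemma div_pi_le_sin {y : ℝ} (h0 : 0 ≤ y) (h1 : y ≤ 2 * Real.pi / 3) :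
    y / Real.pi ≤ Real.sin y := by
  have hpi := Real.pi_pos
  have hs : 2 / Real.pi * (y / 2) ≤ Real.sin (y / 2) :=
    Real.mul_le_sin (by linarith) (by linarith)
  have hc : 1 / 2 ≤ Real.cos (y / 2) := by
    rw [← Real.cos_pi_div_three]
    exact Real.cos_le_cos_of_nonneg_of_le_pi (by linarith) (by linarith) (by linarith)
  have hy : 2 / Real.pi * (y / 2) = y / Real.pi := by ring
  rw [hy] at hs
  have h2 : Real.sin y = 2 * Real.sin (y / 2) * Real.cos (y / 2) := by
    rw [← Real.sin_two_mul]; ring_nf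
  rw [h2]
  have : 0 ≤ y / Real.pi := by positivity
  nlinarith

/-- In the stable regime some curvature in `[1, κ]` either makes the leapfrog trajectory periodic
or yields a large energy error at the mode. -/
lemma exists_curvature {κ η : ℝ} {K : ℕ} (hκ : 10 ≤ κ) (hη : 0 < η) (hK : 1 ≤ K)
    (hq : κ * η ^ 2 < 4) :
    ∃ lam : ℝ, 1 ≤ lam ∧ lam ≤ κ ∧
      ((chebC (1 - lam * η ^ 2 / 2) K = 1 ∧ chebS (1 - lam * η ^ 2 / 2) K = 0) ∨
        ((K : ℝ) * (κ * η ^ 2)) ^ 2 / (648 * Real.pi ^ 2) ≤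
          (lam * η ^ 2) ^ 2 * chebS (1 - lam * η ^ 2 / 2) K ^ 2 / 8) := by
  have hpi := Real.pi_pos
  have hK' : (1 : ℝ) ≤ K := by exact_mod_cast hK
  have hK0 : (0 : ℝ) < K := by linarith
  set q := κ * η ^ 2 with hqdef
  have hq0 : 0 < q := by positivity
  have hη2 : 0 < η ^ 2 := by positivity
  set z := Real.sqrt q with hz
  have hz0 : 0 < z := Real.sqrt_pos.2 hq0
  have hzz : z ^ 2 = q := Real.sq_sqrt hq0.le
  have hz2 : z < 2 := by nlinarith
  -- The angle with `cos θ = 1 - q / 2`, that is, the one for curvature `κ`. An angle `φ`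
  -- corresponds to curvature `4 sin² (φ / 2) / η²`.
  set θ := 2 * Real.arcsin (z / 2) with hθ
  have hsinθ : Real.sin (θ / 2) = z / 2 := by
    rw [hθ, mul_div_cancel_left₀ _ two_ne_zero, Real.sin_arcsin (by linarith) (by linarith)]
  have hθ0 : 0 < θ := by
    have := Real.arcsin_pos.2 (by linarith : 0 < z / 2)
    linarith
  have hθpi : θ < Real.pi := by
    have := Real.arcsin_lt_pi_div_two.2 (by linarith : z / 2 < 1)
    linarith
  have hsin : ∀ φ, θ / 3 ≤ φ → φ ≤ θ → z / 6 ≤ Real.sin (φ / 2) ∧ Real.sin (φ / 2) ≤ z / 2 := by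
    intro φ h1 h2
    constructor
    · have h3 : Real.sin (θ / 6) ≤ Real.sin (φ / 2) :=
        Real.sin_le_sin_of_le_of_le_pi_div_two (by linarith) (by linarith) (by linarith)
      have h4 := Real.sin_three_mul (θ / 6)
      rw [show 3 * (θ / 6) = θ / 2 by ring, hsinθ] at h4
      have h5 : 0 ≤ Real.sin (θ / 6) :=
        Real.sin_nonneg_of_nonneg_of_le_pi (by linarith) (by linarith)
      have h6 : 0 ≤ Real.sin (θ / 6) ^ 3 := by positivity
      linarith
    · rw [← hsinθ]
      exact Real.sin_le_sin_of_le_of_le_pi_div_two (by linarith) (by linarith) (by linarith)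
  -- The lower bound `sin (φ / 2) ≥ z / 6` gives curvature at least `κ / 9`, which exceeds `1` since
  -- `κ ≥ 10`.
  have hcurv : ∀ φ, θ / 3 ≤ φ → φ ≤ θ → 1 ≤ 4 * Real.sin (φ / 2) ^ 2 / η ^ 2 ∧
      4 * Real.sin (φ / 2) ^ 2 / η ^ 2 ≤ κ := by
    intro φ h1 h2
    obtain ⟨h3, h4⟩ := hsin φ h1 h2
    rw [le_div_iff₀ hη2, div_le_iff₀ hη2]
    constructor <;> nlinarith
  have hcos : ∀ φ, 1 - 4 * Real.sin (φ / 2) ^ 2 / η ^ 2 * η ^ 2 / 2 = Real.cos φ := by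
    intro φ
    rw [div_mul_cancel₀ _ hη2.ne', ← mul_div_cancel₀ φ (two_ne_zero' ℝ), Real.cos_two_mul,
      Real.cos_sq', mul_div_cancel₀ φ (two_ne_zero' ℝ)]
    ring
  by_cases hper : 2 * Real.pi ≤ K * θ
  · set y := K * θ / (2 * Real.pi) with hy
    have hy1 : 1 ≤ y := (one_le_div (by positivity)).2 hper
    -- Rounding `Kθ` down to `n` full turns. Since `n ≥ 1`, `y < n + 1 ≤ 2n`, so the angle stays
    -- above `θ / 3`.
    set n := ⌊y⌋₊ with hn
    have hn1 : (1 : ℝ) ≤ n := by exact_mod_cast Nat.le_floor (by simpa using hy1)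
    have hny : (n : ℝ) ≤ y := Nat.floor_le (by linarith)
    have hyn : y < n + 1 := Nat.lt_floor_add_one y
    have hKθ : K * θ = y * (2 * Real.pi) := by rw [hy]; field_simp
    set φ := n * (2 * Real.pi) / K with hφ
    have hKφ : K * φ = n * (2 * Real.pi) := by rw [hφ]; field_simp
    have h2 : φ ≤ θ := by
      refine le_of_mul_le_mul_left ?_ hK0
      rw [hKφ, hKθ]
      gcongr
    have h1 : θ / 3 ≤ φ := by
      refine le_of_mul_le_mul_left ?_ hK0
      rw [hKφ, mul_div_assoc', hKθ]
      nlinarith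
    obtain ⟨hl, hu⟩ := hcurv φ h1 h2
    refine ⟨_, hl, hu, Or.inl ?_⟩
    rw [hcos]
    have hs := chebS_cos φ K
    rw [hKφ, show (n : ℝ) * (2 * Real.pi) = (2 * n : ℕ) * Real.pi by push_cast; ring,
      Real.sin_nat_mul_pi] at hs
    refine ⟨by rw [chebC_cos, hKφ, Real.cos_nat_mul_two_pi], ?_⟩
    exact (mul_eq_zero.1 hs).resolve_right
      (Real.sin_pos_of_pos_of_lt_pi (by linarith) (by linarith)).ne'
  · push Not at hper
    -- The smallest allowed angle keeps `Kφ < 2π / 3`, where `div_pi_le_sin` applies.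
    set φ := θ / 3 with hφ
    have h2 : φ ≤ θ := by linarith
    obtain ⟨hl, hu⟩ := hcurv φ le_rfl h2
    obtain ⟨hs1, -⟩ := hsin φ le_rfl h2
    refine ⟨_, hl, hu, Or.inr ?_⟩
    rw [hcos, div_mul_cancel₀ _ hη2.ne']
    set s := chebS (Real.cos φ) K with hs
    have hsφ : s * Real.sin φ = Real.sin (K * φ) := chebS_cos φ K
    have hKφ : K * φ / Real.pi ≤ Real.sin (K * φ) := by
      apply div_pi_le_sin (by positivity)
      rw [hφ]; linarith
    have hdouble : Real.sin φ = 2 * Real.sin (φ / 2) * Real.cos (φ / 2) := by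
      rw [← Real.sin_two_mul]; ring_nf
    have hσ0 : 0 < Real.sin (φ / 2) := by linarith
    have hφz : z / 3 ≤ φ := by
      have := Real.sin_lt (show 0 < φ / 2 by linarith)
      linarith
    have hspos : 0 ≤ s := by
      have h5 : 0 < Real.sin φ := Real.sin_pos_of_pos_of_lt_pi (by linarith) (by linarith)
      have h6 : 0 ≤ s * Real.sin φ := hsφ ▸ le_trans (by positivity) hKφ
      exact nonneg_of_mul_nonneg_left h6 h5
    have hts : 2 * Real.sin (φ / 2) * Real.sin (K * φ) ≤ 4 * Real.sin (φ / 2) ^ 2 * s := by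
      rw [← hsφ, hdouble]
      have hc1 := Real.cos_le_one (φ / 2)
      have : 4 * Real.sin (φ / 2) ^ 2 * s * Real.cos (φ / 2) ≤ 4 * Real.sin (φ / 2) ^ 2 * s * 1 :=
        mul_le_mul_of_nonneg_left hc1 (by positivity)
      linarith
    have hlow : K * q / (9 * Real.pi) ≤ 4 * Real.sin (φ / 2) ^ 2 * s := by
      refine le_trans ?_ hts
      calc K * q / (9 * Real.pi) = 2 * (z / 6) * (K * (z / 3) / Real.pi) := by
            rw [← hzz]; field_simp; ring
        _ ≤ 2 * Real.sin (φ / 2) * (K * φ / Real.pi) := by gcongr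
        _ ≤ _ := by gcongr
    have hsq := pow_le_pow_left₀ (by positivity) hlow 2
    calc _ = (K * q / (9 * Real.pi)) ^ 2 / 8 := by field_simp; ring
      _ ≤ _ := by rw [← mul_pow]; gcongr

/-- The acceptance probability at the mode is polynomially small in the dimension. -/
lemma one_add_rpow_neg_le {d : ℕ} (hd : 2 ≤ d) {a : ℝ}
    (h : 1 ≤ 2 * a ∨ 10 * Real.log d / d ≤ a) :
    (1 + 2 * a) ^ (-((d : ℝ) / 2)) ≤ 10 ^ 5 / (d : ℝ) ^ 5 := by
  have hd0 : (0 : ℝ) < d := by positivity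
  have hd1 : (1 : ℝ) ≤ d := by exact_mod_cast (by omega : 1 ≤ d)
  have hlogd : 0 ≤ Real.log d := Real.log_nonneg hd1
  rcases le_or_gt 1 (2 * a) with h1 | h1
  · have hlog : Real.log 2 ≤ Real.log (1 + 2 * a) := Real.log_le_log two_pos (by linarith)
    have hl2 := Real.log_two_gt_d9
    rw [Real.rpow_def_of_pos (by linarith), mul_neg, Real.exp_neg,
      ← one_div_div ((d : ℝ) ^ 5), ← one_div]
    refine one_div_le_one_div_of_le (by positivity) ?_
    -- `0.345` lies just below `log 2 / 2`; the fifth Taylor term of `exp` then suffices, as `0.345⁵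
    -- / 120 > 10⁻⁵`.
    have hx : 0.345 * (d : ℝ) ≤ Real.log (1 + 2 * a) * (d / 2) := by nlinarith
    calc (d : ℝ) ^ 5 / 10 ^ 5 ≤ (0.345 * (d : ℝ)) ^ 5 / (Nat.factorial 5 : ℕ) := by
          rw [mul_pow, show Nat.factorial 5 = 120 from rfl]
          have : 0 < (d : ℝ) ^ 5 := by positivity
          norm_num
          nlinarith
      _ ≤ Real.exp (0.345 * d) := Real.pow_div_factorial_le_exp _ (by positivity) 5
      _ ≤ _ := Real.exp_le_exp.2 hx
  · have h2 : 10 * Real.log d / d ≤ a := h.resolve_left (by linarith)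
    have ha : 0 ≤ a := le_trans (by positivity) h2
    rw [div_le_iff₀ hd0] at h2
    -- From `log (1 + x) ≥ 2x / (x + 2)` at `x = 2a`, using `a ≤ 1`.
    have hlog : a ≤ Real.log (1 + 2 * a) := by
      refine le_trans ?_ (Real.le_log_one_add_of_nonneg (by linarith : 0 ≤ 2 * a))
      rw [le_div_iff₀ (by linarith)]
      nlinarith
    have hexp : Real.log (1 + 2 * a) * (-((d : ℝ) / 2)) ≤ -(5 * Real.log d) := by
      nlinarith
    rw [Real.rpow_def_of_pos (by linarith)]
    refine (Real.exp_le_exp.2 hexp).trans ?_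
    rw [Real.exp_neg, show 5 * Real.log d = Real.log ((d : ℝ) ^ 5) by simp,
      Real.exp_log (by positivity), ← one_div]
    gcongr
    norm_num

/-! ### Isotropic targets on Euclidean space -/

lemma quadratic_smul_one {d : ℕ} (lam : ℝ) :
    quadratic (lam • (1 : Matrix (Fin d) (Fin d) ℝ))
      = isoQuad (EuclideanSpace ℝ (Fin d)) lam := by
  ext x
  simp only [quadratic, isoQuad, Matrix.smul_mulVec, Matrix.one_mulVec, dotProduct_smul,
    EuclideanSpace.real_norm_sq_eq]
  simp only [dotProduct, smul_eq_mul, ← sq]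
  ring

lemma integral_acceptProb_isoQuad_zero_le {d : ℕ} (lam η : ℝ) (K : ℕ) :
    ∫ v, acceptProb (isoQuad (EuclideanSpace ℝ (Fin d)) lam) η K (0, v) ∂(stdGaussian _)
      ≤ (1 + 2 * ((lam * η ^ 2) ^ 2 * chebS (1 - lam * η ^ 2 / 2) K ^ 2 / 8))
        ^ (-((d : ℝ) / 2)) := by
  have ha : 0 ≤ (lam * η ^ 2) ^ 2 * chebS (1 - lam * η ^ 2 / 2) K ^ 2 / 8 := by positivity
  have h := integral_exp_neg_mul_sq_norm_stdGaussian (E := EuclideanSpace ℝ (Fin d)) ha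
  rw [finrank_euclideanSpace_fin] at h
  rw [← h]
  refine integral_mono_of_nonneg (ae_of_all _ fun v => acceptProb_nonneg _ _ _ _) ?_
    (ae_of_all _ fun v => acceptProb_isoQuad_zero_le lam η K v)
  refine Integrable.of_bound (by fun_prop) 1 (ae_of_all _ fun v => ?_)
  rw [Real.norm_eq_abs, abs_of_pos (Real.exp_pos _), Real.exp_le_one_iff, neg_mul]
  exact neg_nonpos.2 (by positivity)

lemma ofReal_le_relaxationTime {α : Type*} [MeasurableSpace α] {T : α → Measure α}
    {π : Measure α} {r y : ℝ} (hy : 0 < y) (hgap : spectralGap T π ≤ ENNReal.ofReal r)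
    (hr : r * y ≤ 1) : ENNReal.ofReal y ≤ relaxationTime T π := by
  rw [relaxationTime, ENNReal.le_inv_iff_le_inv, ← ENNReal.ofReal_inv_of_pos hy]
  refine hgap.trans (ENNReal.ofReal_le_ofReal ?_)
  rwa [← one_div, le_div_iff₀ hy]

end HMC

end

theorem theorem4 :
    ∀ C : ℝ, 0 < C → ∃ c : ℝ, 0 < c ∧
      ∀ (d : ℕ) (κ : ℝ), 2 ≤ d → 10 ≤ κ → κ ≤ C * (d : ℝ) ^ 4 →
      ∀ (η : ℝ) (K : ℕ), 0 < η → 1 ≤ K →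
        ∃ A : Matrix (Fin d) (Fin d) ℝ,
          (A - 1).PosSemidef ∧ (κ • (1 : Matrix (Fin d) (Fin d) ℝ) - A).PosSemidef ∧
          ENNReal.ofReal
              (c * (κ * Real.sqrt (d : ℝ) / ((K : ℝ) * Real.sqrt (Real.log (d : ℝ))))) ≤
            HMC.relaxationTime (HMC.transition (HMC.quadratic A) η K)
              (HMC.target (HMC.quadratic A)) := by
  intro C hC
  -- `260` serves the linear test function and `800000 * C` the acceptance bound.
  refine ⟨1 / (260 + 800000 * C), by positivity, ?_⟩
  intro d κ hd hκ hκd η K hη hK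
  set c := 1 / (260 + 800000 * C) with hc
  have hc0 : 0 < c := by positivity
  have hcC : c * 260 + c * (800000 * C) = 1 := by rw [← mul_add, hc, one_div_mul_cancel]; positivity
  have hd2 : (2 : ℝ) ≤ d := by exact_mod_cast hd
  have hd0 : (0 : ℝ) < d := by linarith
  have hK' : (1 : ℝ) ≤ K := by exact_mod_cast hK
  have hK0 : (0 : ℝ) < K := by linarith
  have hlog : 1 / 4 ≤ Real.log d := by
    have h1 := Real.log_le_log two_pos hd2
    have h2 := Real.log_two_gt_d9
    linarith
  set ℓ := Real.sqrt (Real.log d) with hℓ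
  have hℓ2 : ℓ ^ 2 = Real.log d := Real.sq_sqrt (by linarith)
  have hℓh : 1 / 2 ≤ ℓ := Real.le_sqrt_of_sq_le (by linarith)
  have hℓ0 : 0 < ℓ := by linarith
  set r := Real.sqrt (d : ℝ) with hr
  have hr0 : 0 < r := Real.sqrt_pos.2 hd0
  have hr2 : r ^ 2 = d := Real.sq_sqrt hd0.le
  have hy : 0 < c * (κ * r / (K * ℓ)) := by positivity
  have : Nontrivial (EuclideanSpace ℝ (Fin d)) := by
    have : Nonempty (Fin d) := ⟨⟨0, by omega⟩⟩
    infer_instance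
  suffices h : ∃ lam : ℝ, 1 ≤ lam ∧ lam ≤ κ ∧ ENNReal.ofReal (c * (κ * r / (K * ℓ))) ≤
      HMC.relaxationTime (HMC.transition (HMC.isoQuad (EuclideanSpace ℝ (Fin d)) lam) η K)
        (HMC.target (HMC.isoQuad (EuclideanSpace ℝ (Fin d)) lam)) by
    obtain ⟨lam, h1, h2, h3⟩ := h
    refine ⟨lam • 1, ?_, ?_, ?_⟩
    · have := (Matrix.PosSemidef.one (n := Fin d) (R := ℝ)).smul (sub_nonneg.2 h1)
      rwa [sub_smul, one_smul] at this
    · have := (Matrix.PosSemidef.one (n := Fin d) (R := ℝ)).smul (sub_nonneg.2 h2)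
      rwa [sub_smul] at this
    · rwa [HMC.quadratic_smul_one]
  -- low acceptance probability at the mode suffices
  have key : ∀ lam : ℝ, 0 < lam →
      (1 ≤ 2 * ((lam * η ^ 2) ^ 2 * HMC.chebS (1 - lam * η ^ 2 / 2) K ^ 2 / 8) ∨
        10 * Real.log d / d ≤ (lam * η ^ 2) ^ 2 * HMC.chebS (1 - lam * η ^ 2 / 2) K ^ 2 / 8) →
      ENNReal.ofReal (c * (κ * r / (K * ℓ))) ≤
        HMC.relaxationTime (HMC.transition (HMC.isoQuad (EuclideanSpace ℝ (Fin d)) lam) η K)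
          (HMC.target (HMC.isoQuad (EuclideanSpace ℝ (Fin d)) lam)) := by
    intro lam hlam h
    -- The factor `2` only supplies strict inequality.
    have hacc : ∫ v, HMC.acceptProb (HMC.isoQuad (EuclideanSpace ℝ (Fin d)) lam) η K (0, v)
        ∂(stdGaussian _) < 2 * (10 ^ 5 / (d : ℝ) ^ 5) := by
      have h1 := (HMC.integral_acceptProb_isoQuad_zero_le (d := d) lam η K).trans
        (HMC.one_add_rpow_neg_le hd h)
      have h2 : 0 < (10 : ℝ) ^ 5 / (d : ℝ) ^ 5 := by positivity
      linarith
    refine HMC.ofReal_le_relaxationTime hy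
      (HMC.spectralGap_isoQuad_le_acceptProb_zero hlam η K hacc) ?_
    have hrd : r ≤ d := by nlinarith
    have h1 : κ * r / (K * ℓ) ≤ 2 * (C * (d : ℝ) ^ 5) := by
      rw [div_le_iff₀ (by positivity)]
      have h2 : κ * r ≤ C * (d : ℝ) ^ 4 * d := by gcongr
      have h3 : 1 / 2 ≤ K * ℓ := by nlinarith
      have h4 : 0 ≤ C * (d : ℝ) ^ 5 := by positivity
      nlinarith
    calc 2 * (2 * (10 ^ 5 / (d : ℝ) ^ 5)) * (c * (κ * r / (K * ℓ)))
        ≤ 2 * (2 * (10 ^ 5 / (d : ℝ) ^ 5)) * (c * (2 * (C * (d : ℝ) ^ 5))) := by gcongr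
      _ = c * (800000 * C) := by field_simp; norm_num
      _ ≤ 1 := by linarith
  rcases le_or_gt 4 (κ * η ^ 2) with hq | hq
  · refine ⟨κ, by linarith, le_rfl, key κ (by linarith) (Or.inl ?_)⟩
    have hs := HMC.one_le_chebS_sq (w := 1 - κ * η ^ 2 / 2) (by linarith) hK
    nlinarith
  -- The threshold satisfies `260² ≥ 10 * 648 * 10`, where `π² ≤ 10`; above it, the energy error of
  -- `exists_curvature` is at least `10 log d / d`.
  rcases le_or_gt (K * (κ * η ^ 2) * r) (260 * ℓ) with hsmall | hlarge
  · refine ⟨1, le_rfl, by linarith, HMC.ofReal_le_relaxationTime hy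
      (HMC.spectralGap_isoQuad_one_le η K (by nlinarith [sq_nonneg η])) ?_⟩
    calc (K : ℝ) ^ 2 * η ^ 2 * (c * (κ * r / (K * ℓ)))
        = c * (K * (κ * η ^ 2) * r / ℓ) := by field_simp
      _ ≤ c * 260 := by
          gcongr
          rwa [div_le_iff₀ hℓ0]
      _ ≤ 1 := by nlinarith [mul_pos hc0 hC]
  · obtain ⟨lam, h1, h2, h3 | h3⟩ := HMC.exists_curvature hκ hη hK hq
    · refine ⟨lam, h1, h2, ?_⟩
      rw [HMC.relaxationTime, HMC.spectralGap_isoQuad_eq_zero (by linarith) η K h3.1 h3.2]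
      simp
    · refine ⟨lam, h1, h2, key lam (by linarith) (Or.inr (le_trans ?_ h3))⟩
      have hpi : Real.pi ^ 2 ≤ 10 := by nlinarith [Real.pi_lt_d2, Real.pi_pos]
      have hsq := pow_le_pow_left₀ (by positivity) hlarge.le 2
      rw [mul_pow, mul_pow, hℓ2, hr2] at hsq
      rw [div_le_div_iff₀ hd0 (by positivity)]
      nlinarith
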